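/- Let $N\ge 0$ be an integer and let $p,q\ge 0$ with $p+q=1$. Let the $N$-particle asymmetric simple exclusion process (ASEP) be the continuous-time Markov chain on $S=\{(x_1,\dots,x_N)\in\mathbb Z^N : x_1<\dots<x_N\}$ in which every particle jumps one step to the right with rate $p$ and one step to the left with rate $q$, independently of the others, a jump onto an occupied site being suppressed. Let the $N$-particle asymmetric zero range process (AZRP) with constant rate be the continuous-time Markov chain on $S'=\{(x_1,\dots,x_N)\in\mathbb Z^N : x_1\le\dots\le x_N\}$ in which, at every occupied site, one of the particles leaves the site at rate $1$ (whatever the number of particles there) and moves to the neighbouring site on the right with probability $p$ and on the left with probability $q$; the positions are listed in non-decreasing order. Write $P_Y(X;t)$ and $P'_{Y'}(X';t)$ for the probabilities that the ASEP started from $Y\in S$, respectively the AZRP started from $Y'\in S'$, is in the configuration $X\in S$, respectively $X'\in S'$, at time $t\ge 0$. Then: 1. The map $f(x_1,\dots,x_N)=(x_1+1,x_2+2,\dots,x_N+N)$ is a bijection from $S'$ onto $S$. 2. For all $t\ge 0$ and all $X',Y'\in S'$, $$P'_{Y'}(X';t)=P_{f(Y')}(f(X');t).$$ 3. The distribution of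 the position of the $m$-th particle from the left is conserved up to the shift by $m$: for all $t\ge 0$, $Y'\in S'$, $1\le m\le N$ and $x\in\mathbb Z$, the probability that $x_m(t)=x$ in the AZRP started from $Y'$ equals the probability that $x_m(t)=x+m$ in the ASEP started from $f(Y')$. -/

import Mathlib

open scoped NNReal ENNReal Topology
open Filter

/-- The jump rates of a continuous-time Markov chain on a discrete state space `S`: `rate y x` is
the rate at which the chain jumps from `y` to `x`, and the total exit rates are bounded. -/
structure JumpRates (S : Type) where
  rate : S → S → ℝ
  rate_nonneg : ∀ y x, 0 ≤ rate y x
  summable_rate : ∀ y, Summable (rate y)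
  bounded_rate : ∃ C : ℝ, ∀ y, ∑' x, rate y x ≤ C

namespace JumpRates

variable {S : Type}

open Classical in
/-- The generator matrix (`Q`-matrix): the jump rates off the diagonal, and minus the total exit
rate on the diagonal. -/
noncomputable def generator (r : JumpRates S) (y x : S) : ℝ :=
  r.rate y x - if y = x then ∑' z, r.rate y z else 0

open Classical in
/-- `P t y x` is the transition function of the continuous-time Markov chain with the given jump
rates: stochastic matrices that satisfy the Chapman-Kolmogorov equations and whose right derivative
at time `0` is the generator matrix. -/
structure IsTransitionFunction (r : JumpRates S) (P : ℝ≥0 → S → S → ℝ) : Prop where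
  nonneg : ∀ t y x, 0 ≤ P t y x
  hasSum_one : ∀ t y, HasSum (P t y) 1
  initial : ∀ y x, P 0 y x = if y = x then 1 else 0
  chapman_kolmogorov : ∀ s t y x, HasSum (fun z => P s y z * P t z x) (P (s + t) y x)
  deriv_zero : ∀ y x, Tendsto (fun h : ℝ≥0 => (P h y x - P 0 y x) / (h : ℝ)) (𝓝[>] 0)
    (𝓝 (r.generator y x))

theorem hasSum_of_eq {ι E : Type} [AddCommMonoid E] [TopologicalSpace E] {f g : ι → E} {a b : E}
    (h : HasSum f a) (hf : ∀ i, f i = g i) (ha : a = b) : HasSum g b := by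
  rw [← ha, ← funext hf]
  exact h

theorem exists_operator (M : S → S → ℝ) (K : ℝ) (h0 : ∀ y x, 0 ≤ M y x)
    (hM : ∀ y, HasSum (M y) K) :
    ∃ T : lp (fun _ : S => ℝ) 1 →L[ℝ] lp (fun _ : S => ℝ) 1,
      ∀ g x, HasSum (fun y => g y * M y x) (T g x) := by
  have hp : (0 : ℝ) < (1 : ℝ≥0∞).toReal := by simp
  let row : S → lp (fun _ : S => ℝ) 1 := fun y => ⟨M y, memℓp_gen (by
    simpa [abs_of_nonneg (h0 y _)] using (hM y).summable)⟩
  have hrow : ∀ y, ‖row y‖ = K := fun y => by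
    have := lp.hasSum_norm hp (row y)
    simp only [ENNReal.toReal_one, Real.rpow_one] at this
    refine this.unique ?_
    convert hM y using 2 with x
    exact abs_of_nonneg (h0 y x)
  have hnorm : ∀ g : lp (fun _ : S => ℝ) 1, HasSum (fun y => ‖g y • row y‖) (‖g‖ * K) := fun g => by
    have := lp.hasSum_norm hp g
    simp only [ENNReal.toReal_one, Real.rpow_one] at this
    simpa [norm_smul, hrow] using this.mul_right K
  have hs : ∀ g : lp (fun _ : S => ℝ) 1, Summable (fun y => g y • row y) := fun g =>
    (hnorm g).summable.of_norm
  let L : lp (fun _ : S => ℝ) 1 →ₗ[ℝ] lp (fun _ : S => ℝ) 1 :=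
    { toFun := fun g => ∑' y, g y • row y
      map_add' := fun g g' => by
        rw [← (hs g).tsum_add (hs g')]
        simp [add_smul]
      map_smul' := fun c g => by
        simp only [lp.coeFn_smul, Pi.smul_apply, smul_eq_mul, mul_smul, RingHom.id_apply]
        exact (hs g).tsum_const_smul c }
  refine ⟨L.mkContinuous K fun g => ?_, fun g x => ?_⟩
  · calc ‖∑' y, g y • row y‖ ≤ ∑' y, ‖g y • row y‖ := norm_tsum_le_tsum_norm (hnorm g).summable
      _ = K * ‖g‖ := by rw [(hnorm g).tsum_eq, mul_comm]
  · exact (lp.evalCLM ℝ (fun _ : S => ℝ) 1 x).hasSum (hs g).hasSum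

theorem exists_transitionFunction (r : JumpRates S) : ∃ P, r.IsTransitionFunction P := by
  classical
  have hp : (0 : ℝ) < (1 : ℝ≥0∞).toReal := by simp
  obtain ⟨C, hC⟩ := r.bounded_rate
  have hQ : ∀ y, HasSum (fun x => r.generator y x + if y = x then C else 0) C := fun y => by
    have h1 := ((r.summable_rate y).hasSum.sub (hasSum_ite_eq y (∑' z, r.rate y z))).add
      (hasSum_ite_eq y C)
    simpa [generator, eq_comm] using h1
  obtain ⟨B, hB⟩ := exists_operator (fun y x => r.generator y x + if y = x then C else 0) C
    (fun y x => by
      have := r.rate_nonneg y x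
      have := hC y
      unfold generator
      split_ifs <;> linarith) hQ
  have hM0 : ∀ y x, 0 ≤ r.generator y x + if y = x then C else 0 := fun y x => by
    have := r.rate_nonneg y x
    have := hC y
    unfold generator
    split_ifs <;> linarith
  have hsum : ∀ g : lp (fun _ : S => ℝ) 1, Summable fun x => g x := fun g => by
    have := (lp.hasSum_norm hp g).summable
    simp only [ENNReal.toReal_one, Real.rpow_one] at this
    exact this.of_norm
  obtain ⟨σ, hσ⟩ : ∃ σ : lp (fun _ : S => ℝ) 1 →L[ℝ] ℝ, ∀ g, σ g = ∑' x, g x := by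
    let L : lp (fun _ : S => ℝ) 1 →ₗ[ℝ] ℝ :=
      { toFun := fun g => ∑' x, g x
        map_add' := fun g g' => (hsum g).tsum_add (hsum g')
        map_smul' := fun c g => by simp [tsum_mul_left] }
    refine ⟨L.mkContinuous 1 fun g => ?_, fun g => rfl⟩
    have := lp.hasSum_norm hp g
    simp only [ENNReal.toReal_one, Real.rpow_one] at this
    rw [one_mul, ← this.tsum_eq]
    exact norm_tsum_le_tsum_norm this.summable
  have hpos : ∀ g : lp (fun _ : S => ℝ) 1, (∀ x, 0 ≤ g x) → ∀ x, 0 ≤ B g x := fun g hg x =>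
    (hB g x).nonneg fun y => mul_nonneg (hg y) (hM0 y x)
  -- the action on point masses
  have hBe : ∀ y x, B (lp.single 1 y (1 : ℝ)) x = r.generator y x + if y = x then C else 0 :=
    fun y x => by
    refine (hB _ x).unique ?_
    convert hasSum_ite_eq y (r.generator y x + if y = x then C else 0) using 2 with z
    by_cases h : z = y
    · subst h; simp
    · simp [h]
  have hbasis : ∀ g : lp (fun _ : S => ℝ) 1,
      HasSum (fun y => g y • lp.single 1 y (1 : ℝ)) g := fun g => by
    have := lp.hasSum_single (E := fun _ : S => ℝ) (p := 1) (by simp) g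
    convert this using 2 with y
    rw [← lp.single_smul]
    simp
  have hσe : ∀ y, σ (lp.single 1 y (1 : ℝ)) = 1 := fun y => by
    rw [hσ, tsum_eq_single y (fun x hx => by simp [hx])]; simp
  have hσB : ∀ g, σ (B g) = C * σ g := fun g => by
    have h1 := (σ.comp B).hasSum (hbasis g)
    have h2 := (σ.hasSum (hbasis g)).mul_left C
    refine h1.unique (hasSum_of_eq h2 (fun y => ?_) rfl)
    rw [map_smul, map_smul, ContinuousLinearMap.comp_apply, hσe, hσ]
    simp only [hBe]
    rw [(hQ y).tsum_eq, smul_eq_mul, smul_eq_mul]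
    ring
  let U : ℝ → lp (fun _ : S => ℝ) 1 →L[ℝ] lp (fun _ : S => ℝ) 1 := fun t => NormedSpace.exp (t • B)
  have hU : ∀ t g, HasSum (fun n : ℕ => ((n.factorial : ℝ)⁻¹ * t ^ n) • (B ^ n) g) (U t g) :=
    fun t g => by
    have h1 := NormedSpace.exp_series_hasSum_exp' (𝕂 := ℝ) (t • B)
    have h2 := (ContinuousLinearMap.apply ℝ (lp (fun _ : S => ℝ) 1) g).hasSum h1
    refine hasSum_of_eq h2 (fun n => ?_) rfl
    simp [smul_pow, mul_smul]
  have hUadd : ∀ s t, U (s + t) = U s * U t := fun s t => by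
    simp only [U, add_smul]
    let _ : NormedAlgebra ℚ (lp (fun _ : S => ℝ) 1 →L[ℝ] lp (fun _ : S => ℝ) 1) :=
      NormedAlgebra.restrictScalars ℚ ℝ _
    exact NormedSpace.exp_add_of_commute ((Commute.refl B).smul_left s |>.smul_right t)
  have hpow : ∀ (n : ℕ) (g : lp (fun _ : S => ℝ) 1), (∀ x, 0 ≤ g x) → ∀ x, 0 ≤ (B ^ n) g x := by
    intro n
    induction n with
    | zero => intro g hg x; simpa using hg x
    | succ n ih => intro g hg x; rw [pow_succ]; exact ih (B g) (hpos g hg) x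
  have hσpow : ∀ (n : ℕ) (g : lp (fun _ : S => ℝ) 1), σ ((B ^ n) g) = C ^ n * σ g := by
    intro n
    induction n with
    | zero => intro g; simp
    | succ n ih =>
      intro g
      have h : (B ^ (n + 1)) g = (B ^ n) (B g) := by rw [pow_succ]; rfl
      rw [h, ih, hσB, pow_succ, mul_assoc]
  have hσU : ∀ t g, σ (U t g) = Real.exp (t * C) * σ g := fun t g => by
    have h1 := σ.hasSum (hU t g)
    have h2 := (NormedSpace.exp_series_hasSum_exp' (𝕂 := ℝ) (t * C)).mul_right (σ g)
    rw [← Real.exp_eq_exp_ℝ] at h2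
    refine h1.unique (hasSum_of_eq h2 (fun n => ?_) rfl)
    rw [map_smul, hσpow, smul_eq_mul, smul_eq_mul, mul_pow]
    ring
  refine ⟨fun t y x => Real.exp (-(t * C)) * U t (lp.single 1 y (1 : ℝ)) x, ?_, ?_, ?_, ?_, ?_⟩
  · intro t y x
    refine mul_nonneg (Real.exp_nonneg _) ?_
    have h1 := (lp.evalCLM ℝ (fun _ : S => ℝ) 1 x).hasSum (hU t (lp.single 1 y (1 : ℝ)))
    refine h1.nonneg fun n => ?_
    have : 0 ≤ (B ^ n) (lp.single 1 y (1 : ℝ)) x := hpow n _ (fun z => by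
      rw [lp.single_apply, Pi.single_apply]; split_ifs <;> norm_num) x
    have h2 : (0 : ℝ) ≤ (n.factorial : ℝ)⁻¹ * (t : ℝ) ^ n := by positivity
    exact mul_nonneg h2 this
  · intro t y
    have h1 := (hsum (U t (lp.single 1 y (1 : ℝ)))).hasSum
    rw [← hσ, hσU, hσe] at h1
    refine hasSum_of_eq (h1.mul_left (Real.exp (-(t * C)))) (fun _ => rfl) ?_
    rw [mul_one, ← Real.exp_add]
    simp
  · intro y x
    simp [U, Pi.single_apply, eq_comm]
  · intro s t y x
    have h1 := ((lp.evalCLM ℝ (fun _ : S => ℝ) 1 x).comp (U t)).hasSum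
      (hbasis (U s (lp.single 1 y (1 : ℝ))))
    have h2 := h1.mul_left (Real.exp (-((s + t) * C)))
    have h3 : U ((s + t : ℝ≥0) : ℝ) = U t * U s := by
      rw [NNReal.coe_add, add_comm, hUadd]
    refine hasSum_of_eq h2 (fun z => ?_) (by rw [h3]; rfl)
    rw [map_smul, smul_eq_mul, add_mul, neg_add, Real.exp_add]
    have : ((lp.evalCLM ℝ (fun _ : S => ℝ) 1 x).comp (U t)) (lp.single 1 z (1 : ℝ)) =
      U t (lp.single 1 z (1 : ℝ)) x := rfl
    rw [this]
    ring
  · intro y x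
    have h1 : HasDerivAt U B 0 := by
      have := hasDerivAt_exp_smul_const (𝕂 := ℝ) B (0 : ℝ)
      simpa [U] using this
    have h2 : HasDerivAt (fun t => U t (lp.single 1 y (1 : ℝ)) x)
        (B (lp.single 1 y (1 : ℝ)) x) 0 := by
      have := ((lp.evalCLM ℝ (fun _ : S => ℝ) 1 x).comp
        (ContinuousLinearMap.apply ℝ (lp (fun _ : S => ℝ) 1)
          (lp.single 1 y (1 : ℝ) : lp (fun _ : S => ℝ) 1))).hasFDerivAt.comp_hasDerivAt (0 : ℝ) h1
      exact this
    have h3 : HasDerivAt (fun t : ℝ => Real.exp (-(t * C))) (-C) 0 := by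
      have := (((hasDerivAt_id (0 : ℝ)).mul_const C).neg).exp
      simpa using this
    have h4 := h3.mul h2
    have h5 := h4.tendsto_slope_zero_right
    have h6 : Tendsto (fun h : ℝ≥0 => (h : ℝ)) (𝓝[>] 0) (𝓝[>] 0) := by
      refine tendsto_nhdsWithin_iff.2 ⟨?_, ?_⟩
      · exact (NNReal.continuous_coe.tendsto' 0 0 (by simp)).mono_left nhdsWithin_le_nhds
      · filter_upwards [self_mem_nhdsWithin] with h hh
        exact_mod_cast hh
    have h7 := h5.comp h6
    convert h7 using 2 with h
    · simp [U, div_eq_inv_mul]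
    · by_cases hxy : y = x
      · subst hxy; simp [hBe, U]
      · simp [hBe, U, hxy, Ne.symm hxy]

theorem tendsto_tsum_mul {ι : Type} {l : Filter ι} {a : ι → S → ℝ} {b g : S → ℝ} {c : ℝ}
    (ha0 : ∀ᶠ i in l, ∀ z, 0 ≤ a i z) (ha : ∀ i, HasSum (a i) c) (hb0 : ∀ z, 0 ≤ b z)
    (hb : HasSum b c) (hab : ∀ z, Tendsto (fun i => a i z) l (𝓝 (b z))) (hg : ∀ z, |g z| ≤ 1) :
    Tendsto (fun i => ∑' z, a i z * g z) l (𝓝 (∑' z, b z * g z)) := by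
  have hm : Tendsto (fun i => ∑' z, min (a i z) (b z)) l (𝓝 (∑' z, b z)) := by
    refine tendsto_tsum_of_dominated_convergence hb.summable (fun z => ?_) ?_
    · simpa using (hab z).min (tendsto_const_nhds (x := b z))
    · filter_upwards [ha0] with i hi z
      rw [Real.norm_eq_abs, abs_of_nonneg (le_min (hi z) (hb0 z))]
      exact min_le_right _ _
  rw [hb.tsum_eq] at hm
  have h2 : Tendsto (fun i => 2 * (c - ∑' z, min (a i z) (b z))) l (𝓝 0) := by
    simpa using ((tendsto_const_nhds (x := c)).sub hm).const_mul 2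
  rw [tendsto_iff_norm_sub_tendsto_zero]
  refine tendsto_of_tendsto_of_tendsto_of_le_of_le' tendsto_const_nhds h2
    (Eventually.of_forall fun i => norm_nonneg _) ?_
  filter_upwards [ha0] with i hi
  have hs : ∀ f : S → ℝ, (∀ z, 0 ≤ f z) → Summable f → Summable fun z => f z * g z :=
    fun f hf0 hf => Summable.of_norm_bounded hf fun z => by
      rw [norm_mul, Real.norm_eq_abs, Real.norm_eq_abs, abs_of_nonneg (hf0 z)]
      exact mul_le_of_le_one_right (hf0 z) (hg z)
  have hmin : Summable fun z => min (a i z) (b z) :=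
    Summable.of_nonneg_of_le (fun z => le_min (hi z) (hb0 z)) (fun z => min_le_right _ _)
      hb.summable
  have h3 := (((ha i).add hb).sub (hmin.hasSum.mul_left 2))
  rw [← (hs _ hi (ha i).summable).tsum_sub (hs _ hb0 hb.summable)]
  refine (tsum_of_norm_bounded h3 fun z => ?_).trans (by linarith)
  rw [← sub_mul, norm_mul, Real.norm_eq_abs, Real.norm_eq_abs]
  refine (mul_le_of_le_one_right (abs_nonneg _) (hg z)).trans ?_
  rcases le_total (a i z) (b z) with h | h
  · rw [min_eq_left h, abs_of_nonpos (by linarith)]; linarith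
  · rw [min_eq_right h, abs_of_nonneg (by linarith)]; linarith

namespace IsTransitionFunction

variable {r : JumpRates S} {P P' : ℝ≥0 → S → S → ℝ}

theorem le_one (hP : r.IsTransitionFunction P) (t : ℝ≥0) (y x : S) : P t y x ≤ 1 :=
  le_hasSum (hP.hasSum_one t y) x fun z _ => hP.nonneg t y z

theorem tendsto_right (hP : r.IsTransitionFunction P) (y : S) {g : S → ℝ} (hg : ∀ z, |g z| ≤ 1) :
    Tendsto (fun h : ℝ≥0 => (∑' z, P h y z * g z - g y) / (h : ℝ)) (𝓝[>] 0)
      (𝓝 (∑' z, r.generator y z * g z)) := by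
  classical
  set K : ℝ := ∑' z, r.rate y z + 1 with hK
  have hQ : HasSum (fun x => r.generator y x + if y = x then K else 0) K := by
    have h1 := ((r.summable_rate y).hasSum.sub (hasSum_ite_eq y (∑' z, r.rate y z))).add
      (hasSum_ite_eq y K)
    simpa [generator, eq_comm] using h1
  have hd : ∀ x, HasSum (fun z => P 0 x z) 1 := hP.hasSum_one 0
  have hgen : ∀ z, z ≠ y → 0 ≤ r.generator y z := fun z hz => by
    simpa [generator, Ne.symm hz] using r.rate_nonneg y z
  have hgeny : 0 < r.generator y y + K := by
    have := r.rate_nonneg y y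
    simp only [generator, if_true]
    linarith
  have hsP : ∀ h, Summable fun z => P h y z * g z := fun h =>
    Summable.of_norm_bounded (hP.hasSum_one h y).summable fun z => by
      rw [norm_mul, Real.norm_eq_abs, Real.norm_eq_abs, abs_of_nonneg (hP.nonneg h y z)]
      exact mul_le_of_le_one_right (hP.nonneg h y z) (hg z)
  have key := tendsto_tsum_mul (l := 𝓝[>] (0 : ℝ≥0)) (g := g) (c := K)
    (a := fun h z => (P h y z - P 0 y z) / (h : ℝ) + if y = z then K else 0)
    (b := fun z => r.generator y z + if y = z then K else 0) ?_ ?_ ?_ hQ ?_ hg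
  · have h1 := key.sub_const (K * g y)
    have hgs : Summable fun z => r.generator y z * g z := by
      have hs : Summable fun z => (r.generator y z) := by
        have := hQ.summable.sub (hasSum_ite_eq y K).summable
        simpa [eq_comm] using this
      refine Summable.of_norm_bounded hs.abs fun z => ?_
      rw [norm_mul, Real.norm_eq_abs, Real.norm_eq_abs]
      exact mul_le_of_le_one_right (abs_nonneg _) (hg z)
    have hK : HasSum (fun z => (if y = z then K else 0) * g z) (K * g y) :=
      hasSum_of_eq (hasSum_ite_eq y (K * g y)) (fun z => by
        by_cases h : z = y
        · subst h; simp
        · simp [h, Ne.symm h]) rfl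
    refine (h1.congr fun h => ?_).trans (le_of_eq ?_)
    · have h0 : HasSum (fun z => P 0 y z * g z) (g y) :=
        hasSum_of_eq (hasSum_ite_eq y (g y)) (fun z => by
          by_cases h : z = y
          · subst h; simp [hP.initial]
          · simp [h, Ne.symm h, hP.initial]) rfl
      have h2 := (((hsP h).hasSum.sub h0).div_const (h : ℝ)).add hK
      have h3 := (hasSum_of_eq h2 (g := fun z =>
        ((P h y z - P 0 y z) / (h : ℝ) + if y = z then K else 0) * g z)
        (fun z => by ring) rfl).tsum_eq
      rw [h3]; ring
    · have h2 := (hasSum_of_eq (hgs.hasSum.add hK) (g := fun z =>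
        (r.generator y z + if y = z then K else 0) * g z) (fun z => by ring) rfl).tsum_eq
      rw [h2]; ring_nf
  · have h1 := (hP.deriv_zero y y).eventually (lt_mem_nhds (show -K < r.generator y y by linarith))
    filter_upwards [h1] with h hh z
    by_cases hz : z = y
    · subst hz; simp only [if_true]; linarith
    · simp only [Ne.symm hz, if_false, add_zero, hP.initial, sub_zero]
      exact div_nonneg (hP.nonneg _ _ _) h.2
  · intro h
    refine hasSum_of_eq ((((hP.hasSum_one h y).sub (hP.hasSum_one 0 y)).div_const (h : ℝ)).add
      (hasSum_ite_eq y K)) (fun z => by simp only [eq_comm]) (by simp)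
  · intro z
    by_cases hz : z = y
    · subst hz; simp only [if_true]; linarith
    · simpa [Ne.symm hz] using hgen z hz
  · intro z
    exact (hP.deriv_zero y z).add_const _

theorem abs_sub_le (hP : r.IsTransitionFunction P) (h t : ℝ≥0) (y x : S) :
    |P (h + t) y x - P t y x| ≤ 1 - P h y y := by
  classical
  have h1 := hP.chapman_kolmogorov h t y x
  have h2 := h1.sub (hasSum_ite_eq y (P h y y * P t y x))
  have h3 := (hP.hasSum_one h y).sub (hasSum_ite_eq y (P h y y))
  have hle : P (h + t) y x - P h y y * P t y x ≤ 1 - P h y y := hasSum_le (fun z => by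
    by_cases hz : z = y
    · subst hz; simp
    · simpa [hz] using mul_le_of_le_one_right (hP.nonneg h y z) (hP.le_one t z x)) h2 h3
  have hge : 0 ≤ P (h + t) y x - P h y y * P t y x := h2.nonneg fun z => by
    by_cases hz : z = y
    · subst hz; simp
    · simpa [hz] using mul_nonneg (hP.nonneg h y z) (hP.nonneg t z x)
  have h4 := hP.le_one h y y
  have h5 := hP.le_one t y x
  have h6 := hP.nonneg t y x
  rw [abs_le]
  constructor <;> nlinarith

theorem continuous_time (hP : r.IsTransitionFunction P) (y x : S) :
    Continuous fun t : ℝ≥0 => P t y x := by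
  have h0 : Tendsto (fun h : ℝ≥0 => P h y y) (𝓝 0) (𝓝 1) := by
    have h1 := hP.deriv_zero y y
    have h2 : Tendsto (fun h : ℝ≥0 => (h : ℝ)) (𝓝[>] 0) (𝓝 0) :=
      (NNReal.continuous_coe.tendsto' 0 0 (by simp)).mono_left nhdsWithin_le_nhds
    have h3 := (h1.mul h2).add_const (1 : ℝ)
    rw [mul_zero, zero_add] at h3
    have h4 : Tendsto (fun h : ℝ≥0 => P h y y) (𝓝[>] 0) (𝓝 1) := by
      refine h3.congr' ?_
      filter_upwards [self_mem_nhdsWithin] with h hh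
      have : (h : ℝ) ≠ 0 := by
        have : (0 : ℝ≥0) < h := hh
        positivity
      rw [div_mul_cancel₀ _ this, hP.initial]
      simp
    have h5 : insert 0 (Set.Ioi (0 : ℝ≥0)) = Set.univ := by
      ext a
      simp
    rw [← nhdsWithin_univ, ← h5, nhdsWithin_insert]
    refine Tendsto.sup ?_ h4
    rw [tendsto_pure_left]
    intro s hs
    simpa [hP.initial] using mem_of_mem_nhds hs
  rw [Metric.continuous_iff]
  intro t ε hε
  obtain ⟨δ, hδ, h⟩ := Metric.tendsto_nhds_nhds.1 h0 ε hε
  refine ⟨δ, hδ, fun s hs => ?_⟩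
  have key : ∀ u v : ℝ≥0, u ≤ v → dist v u < δ → |P v y x - P u y x| < ε := fun u v huv hd => by
    have h1 := hP.abs_sub_le (v - u) u y x
    rw [tsub_add_cancel_of_le huv] at h1
    have h2 : dist (P (v - u) y y) 1 < ε := h (by
      rw [NNReal.dist_eq] at hd ⊢
      rwa [NNReal.coe_sub huv, NNReal.coe_zero, sub_zero])
    rw [Real.dist_eq, abs_lt] at h2
    linarith
  rw [Real.dist_eq]
  rcases le_total t s with hts | hts
  · exact key t s hts hs
  · rw [abs_sub_comm]
    exact key s t hts (by rwa [dist_comm])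

theorem hasDerivWithinAt (hP : r.IsTransitionFunction P) (y x : S) {t : ℝ} (ht : 0 ≤ t) :
    HasDerivWithinAt (fun s : ℝ => P s.toNNReal y x) (∑' z, r.generator y z * P t.toNNReal z x)
      (Set.Ici t) t := by
  have h1 := hP.tendsto_right y (g := fun z => P t.toNNReal z x) fun z => by
    rw [abs_of_nonneg (hP.nonneg _ _ _)]
    exact hP.le_one _ _ _
  rw [← hasDerivWithinAt_Ioi_iff_Ici, hasDerivWithinAt_iff_tendsto_slope' (by simp)]
  have h2 : Tendsto (fun s : ℝ => (s - t).toNNReal) (𝓝[>] t) (𝓝[>] 0) := by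
    refine tendsto_nhdsWithin_iff.2 ⟨?_, ?_⟩
    · exact ((continuous_real_toNNReal.comp (continuous_sub_right t)).tendsto' t 0
        (by simp)).mono_left nhdsWithin_le_nhds
    · filter_upwards [self_mem_nhdsWithin] with s hs
      simpa using hs
  refine (h1.comp h2).congr' ?_
  filter_upwards [self_mem_nhdsWithin] with s hs
  have hs' : t < s := hs
  have h3 : (s - t).toNNReal + t.toNNReal = s.toNNReal := by
    rw [← Real.toNNReal_add (by linarith) ht, sub_add_cancel]
  simp only [Function.comp, (hP.chapman_kolmogorov _ _ _ _).tsum_eq, h3]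
  rw [slope_def_field, Real.coe_toNNReal _ (by linarith)]

theorem unique (hP : r.IsTransitionFunction P) (hP' : r.IsTransitionFunction P') : P = P' := by
  classical
  obtain ⟨C₀, hC₀⟩ := r.bounded_rate
  set C := max C₀ 0 with hC
  have hrC : ∀ y, ∑' z, r.rate y z ≤ C := fun y => (hC₀ y).trans (le_max_left _ _)
  have hC0 : 0 ≤ C := le_max_right _ _
  have hgs : ∀ y, HasSum (fun z => r.rate y z + if z = y then ∑' w, r.rate y w else 0)
      (∑' z, r.rate y z + ∑' z, r.rate y z) := fun y =>
    (r.summable_rate y).hasSum.add (hasSum_ite_eq y _)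
  have hgle : ∀ y z, |r.generator y z| ≤ r.rate y z + if z = y then ∑' w, r.rate y w else 0 := by
    intro y z
    have h1 := r.rate_nonneg y z
    have h2 : 0 ≤ ∑' w, r.rate y w := tsum_nonneg (r.rate_nonneg y)
    by_cases hz : z = y
    · subst hz
      simp only [generator, if_true, abs_le]
      constructor <;> linarith
    · simp [generator, hz, Ne.symm hz, abs_of_nonneg h1]
  -- bound for the generator applied to a bounded function
  have hbd : ∀ (y : S) (g : S → ℝ) (M : ℝ), (∀ z, |g z| ≤ M) →
      Summable (fun z => r.generator y z * g z) ∧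
        ‖∑' z, r.generator y z * g z‖ ≤ 2 * C * M := by
    intro y g M hg
    have hM : 0 ≤ M := (abs_nonneg _).trans (hg y)
    have h1 : ∀ z, ‖r.generator y z * g z‖ ≤
        (r.rate y z + if z = y then ∑' w, r.rate y w else 0) * M := fun z => by
      rw [norm_mul, Real.norm_eq_abs, Real.norm_eq_abs]
      exact mul_le_mul (hgle y z) (hg z) (abs_nonneg _) ((abs_nonneg _).trans (hgle y z))
    refine ⟨Summable.of_norm_bounded ((hgs y).mul_right M).summable h1, ?_⟩
    refine (tsum_of_norm_bounded ((hgs y).mul_right M) h1).trans ?_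
    have := hrC y
    exact mul_le_mul_of_nonneg_right (by linarith) hM
  funext t y x
  have key : ∀ (n : ℕ) (y : S) (t : ℝ), 0 ≤ t →
      |P t.toNNReal y x - P' t.toNNReal y x| ≤ (2 * C * t) ^ n / n.factorial := by
    intro n
    induction n with
    | zero =>
      intro y t _
      have h1 := hP.nonneg t.toNNReal y x
      have h2 := hP.le_one t.toNNReal y x
      have h3 := hP'.nonneg t.toNNReal y x
      have h4 := hP'.le_one t.toNNReal y x
      simp only [pow_zero, Nat.factorial_zero, Nat.cast_one, div_one, abs_le]
      constructor <;> linarith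
    | succ n ih =>
      intro y T hT
      have hc : Continuous fun s : ℝ => P s.toNNReal y x - P' s.toNNReal y x :=
        ((hP.continuous_time y x).comp continuous_real_toNNReal).sub
          ((hP'.continuous_time y x).comp continuous_real_toNNReal)
      refine image_norm_le_of_norm_deriv_right_le_deriv_boundary (a := 0) (b := T)
        (f := fun s : ℝ => P s.toNNReal y x - P' s.toNNReal y x)
        (f' := fun s => ∑' z, r.generator y z * P s.toNNReal z x -
          ∑' z, r.generator y z * P' s.toNNReal z x)
        (B := fun s => (2 * C * s) ^ (n + 1) / (n + 1).factorial)
        (B' := fun s => 2 * C * ((2 * C * s) ^ n / n.factorial)) hc.continuousOn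
        (fun s hs => (hP.hasDerivWithinAt y x hs.1).sub (hP'.hasDerivWithinAt y x hs.1)) ?_ ?_ ?_
        ⟨hT, le_rfl⟩
      · simp [hP.initial, hP'.initial]
      · intro s
        have h1 := (((hasDerivAt_id s).const_mul (2 * C)).pow (n + 1)).div_const
          ((n + 1).factorial : ℝ)
        have h2 : (n.factorial : ℝ) ≠ 0 := by positivity
        have h3 : ((n : ℝ) + 1) ≠ 0 := by positivity
        have h4 : ((n + 1 : ℕ) : ℝ) * (2 * C * id s) ^ (n + 1 - 1) * (2 * C * 1) /
            ((n + 1).factorial : ℝ) = 2 * C * ((2 * C * s) ^ n / n.factorial) := by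
          rw [Nat.factorial_succ]
          push_cast
          simp only [id]
          field_simp
        rw [h4] at h1
        exact h1
      · intro s hs
        have h1 : ∀ (Q : ℝ≥0 → S → S → ℝ), r.IsTransitionFunction Q → ∀ z,
            |Q s.toNNReal z x| ≤ 1 := fun Q hQ z => by
          rw [abs_of_nonneg (hQ.nonneg _ _ _)]
          exact hQ.le_one _ _ _
        rw [← ((hbd y _ 1 (h1 P hP)).1).tsum_sub (hbd y _ 1 (h1 P' hP')).1]
        simp only [← mul_sub]
        exact (hbd y _ _ fun z => ih z s hs.1).2
  have hlim : Tendsto (fun n : ℕ => (2 * C * (t : ℝ)) ^ n / n.factorial) atTop (𝓝 0) :=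
    FloorSemiring.tendsto_pow_div_factorial_atTop _
  have h1 : |P t y x - P' t y x| ≤ 0 := ge_of_tendsto' hlim fun n => by
    simpa using key n y t t.2
  exact sub_eq_zero.1 (abs_nonpos_iff.1 h1)

end IsTransitionFunction

theorem existsUnique_transitionFunction (r : JumpRates S) : ∃! P, r.IsTransitionFunction P := by
  obtain ⟨P, hP⟩ := r.exists_transitionFunction
  exact ⟨P, hP, fun P' hP' => hP'.unique hP⟩

/-- The transition probabilities of the continuous-time Markov chain with the given jump rates:
`r.transitionProb t y x` is the probability that the chain started from `y` is in the state `x`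
at time `t`. -/
noncomputable def transitionProb (r : JumpRates S) : ℝ≥0 → S → S → ℝ :=
  r.existsUnique_transitionFunction.choose

theorem isTransitionFunction_transitionProb (r : JumpRates S) :
    r.IsTransitionFunction r.transitionProb :=
  r.existsUnique_transitionFunction.choose_spec.1

/-- The law at time `t` of the continuous-time Markov chain with the given jump rates started from
the state `y`. -/
noncomputable def law (r : JumpRates S) (t : ℝ≥0) (y : S) : PMF S :=
  ⟨fun x => ENNReal.ofReal (r.transitionProb t y x), by
    have hP := r.isTransitionFunction_transitionProb
    have h := (hP.hasSum_one t y).summable.hasSum_iff.1 (hP.hasSum_one t y)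
    rw [← ENNReal.ofReal_one, ← h, ENNReal.ofReal_tsum_of_nonneg (hP.nonneg t y)
      (hP.hasSum_one t y).summable]
    exact ENNReal.summable.hasSum⟩

end JumpRates

/-- The state space of the ASEP with `N` particles: the positions `x₁ < ⋯ < x_N`. -/
def ASEPConfig (N : ℕ) : Type := {x : Fin N → ℤ // StrictMono x}

/-- The state space of the AZRP with `N` particles: the positions `x₁ ≤ ⋯ ≤ x_N`. -/
def AZRPConfig (N : ℕ) : Type := {x : Fin N → ℤ // Monotone x}

theorem summable_ite_of_subsingleton {S : Type} (A : S → Prop) [DecidablePred A]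
    (hA : ∀ a b, A a → A b → a = b) (c : ℝ≥0) :
    Summable (fun x => if A x then (c : ℝ) else 0) ∧
      ∑' x, (if A x then (c : ℝ) else 0) ≤ c := by
  by_cases h : ∃ a, A a
  · obtain ⟨a, ha⟩ := h
    have h1 : ∀ x, x ≠ a → (if A x then (c : ℝ) else 0) = 0 := fun x hx =>
      if_neg fun hx' => hx (hA x a hx' ha)
    have h2 := hasSum_single a h1
    rw [if_pos ha] at h2
    exact ⟨h2.summable, h2.tsum_eq.le⟩
  · have h1 : (fun x => if A x then (c : ℝ) else 0) = fun _ => 0 := by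
      funext x
      exact if_neg fun hx => h ⟨x, hx⟩
    rw [h1]
    exact ⟨summable_zero, by simp⟩

theorem summable_sum_ite {S ι : Type} {N : ℕ} (s : Finset ι) (hs : s.card ≤ N)
    (A B : ι → S → Prop) [∀ i, DecidablePred (A i)] [∀ i, DecidablePred (B i)]
    (hA : ∀ i a b, A i a → A i b → a = b) (hB : ∀ i a b, B i a → B i b → a = b) (p q : ℝ≥0) :
    Summable (fun x => ∑ i ∈ s, ((if A i x then (p : ℝ) else 0) + if B i x then (q : ℝ) else 0)) ∧
      ∑' x, ∑ i ∈ s, ((if A i x then (p : ℝ) else 0) + if B i x then (q : ℝ) else 0) ≤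
        N * (p + q) := by
  have h1 := fun i => summable_ite_of_subsingleton (A i) (hA i) p
  have h2 := fun i => summable_ite_of_subsingleton (B i) (hB i) q
  refine ⟨summable_sum fun i _ => (h1 i).1.add (h2 i).1, ?_⟩
  rw [Summable.tsum_finsetSum fun i _ => (h1 i).1.add (h2 i).1]
  calc ∑ i ∈ s, ∑' x, ((if A i x then (p : ℝ) else 0) + if B i x then (q : ℝ) else 0)
      ≤ ∑ i ∈ s, ((p : ℝ) + q) := Finset.sum_le_sum fun i _ => by
        rw [(h1 i).1.tsum_add (h2 i).1]
        exact add_le_add (h1 i).2 (h2 i).2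
    _ = s.card * (p + q) := by rw [Finset.sum_const, nsmul_eq_mul]
    _ ≤ N * (p + q) := by gcongr

/-- The asymmetric simple exclusion process with `N` particles: every particle jumps one step to
the right with rate `p` and one step to the left with rate `q`, provided that the target site is
vacant. A jump onto an occupied site is suppressed because it does not lead to a configuration
`x₁ < ⋯ < x_N`. -/
noncomputable def asep (N : ℕ) (p q : ℝ≥0) : JumpRates (ASEPConfig N) where
  rate y x := ∑ i : Fin N,
    ((if x.1 = Function.update y.1 i (y.1 i + 1) then (p : ℝ) else 0) +
      (if x.1 = Function.update y.1 i (y.1 i - 1) then (q : ℝ) else 0))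
  rate_nonneg y x := by positivity
  summable_rate y := (summable_sum_ite (N := N) Finset.univ (by simp)
    (fun i (x : ASEPConfig N) => x.1 = Function.update y.1 i (y.1 i + 1))
    (fun i (x : ASEPConfig N) => x.1 = Function.update y.1 i (y.1 i - 1))
    (fun _ _ _ h h' => Subtype.ext (h.trans h'.symm))
    (fun _ _ _ h h' => Subtype.ext (h.trans h'.symm)) p q).1
  bounded_rate := ⟨N * (p + q), fun y => (summable_sum_ite (N := N) Finset.univ (by simp)
    (fun i (x : ASEPConfig N) => x.1 = Function.update y.1 i (y.1 i + 1))
    (fun i (x : ASEPConfig N) => x.1 = Function.update y.1 i (y.1 i - 1))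
    (fun _ _ _ h h' => Subtype.ext (h.trans h'.symm))
    (fun _ _ _ h h' => Subtype.ext (h.trans h'.symm)) p q).2⟩

namespace AZRPConfig

variable {N : ℕ}

/-- The number of particles at each site. -/
def occupation (x : AZRPConfig N) (s : ℤ) : ℕ := (Finset.univ.filter fun i => x.1 i = s).card

/-- The set of occupied sites. -/
def occupiedSites (x : AZRPConfig N) : Finset ℤ := Finset.univ.image x.1

/-- The configuration `x` arises from `y` when one of the particles at `s` moves to `s'`. -/
def IsMove (y x : AZRPConfig N) (s s' : ℤ) : Prop :=
  x.occupation + Pi.single s 1 = y.occupation + Pi.single s' 1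

theorem ext_occupation {x y : AZRPConfig N} (h : x.occupation = y.occupation) : x = y := by
  obtain ⟨σ, hσ⟩ : ∃ σ : Equiv.Perm (Fin N), x.1 = y.1 ∘ σ := by
    have h1 : ∀ s : ℤ, Nonempty ({i // x.1 i = s} ≃ {i // y.1 i = s}) := fun s => by
      rw [← Fintype.card_eq, Fintype.card_subtype, Fintype.card_subtype]
      exact congrFun h s
    refine ⟨Equiv.ofFiberEquiv fun s => (h1 s).some, ?_⟩
    funext i
    exact (Equiv.ofFiberEquiv_map (fun s => (h1 s).some) i).symm
  apply Subtype.ext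
  have h2 := Tuple.unique_monotone (f := y.1) (σ := σ) (τ := 1) (hσ ▸ x.2) y.2
  rw [hσ, h2]
  rfl

theorem IsMove.unique {y x x' : AZRPConfig N} {s s' : ℤ} (h : y.IsMove x s s')
    (h' : y.IsMove x' s s') : x = x' :=
  ext_occupation (add_right_cancel (h.trans h'.symm))

end AZRPConfig

open Classical in
/-- The asymmetric zero range process with `N` particles and constant rate: at every occupied site,
one of the particles leaves at rate `1`, whatever the number of particles there, and it moves to the
site on the right with probability `p` and to the site on the left with probability `q`. -/
noncomputable def azrp (N : ℕ) (p q : ℝ≥0) : JumpRates (AZRPConfig N) where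
  rate y x := ∑ s ∈ y.occupiedSites,
    ((if y.IsMove x s (s + 1) then (p : ℝ) else 0) + (if y.IsMove x s (s - 1) then (q : ℝ) else 0))
  rate_nonneg y x := by positivity
  summable_rate y := (summable_sum_ite (N := N) y.occupiedSites
    (Finset.card_image_le.trans (by simp)) (fun s x => y.IsMove x s (s + 1))
    (fun s x => y.IsMove x s (s - 1)) (fun _ _ _ h h' => h.unique h')
    (fun _ _ _ h h' => h.unique h') p q).1
  bounded_rate := ⟨N * (p + q), fun y => (summable_sum_ite (N := N) y.occupiedSites
    (Finset.card_image_le.trans (by simp)) (fun s x => y.IsMove x s (s + 1))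
    (fun s x => y.IsMove x s (s - 1)) (fun _ _ _ h h' => h.unique h')
    (fun _ _ _ h h' => h.unique h') p q).2⟩

/-- The map `(x₁, …, x_N) ↦ (x₁ + 1, …, x_N + N)`. The index `i : Fin N` stands for the particle
with number `i + 1` from the left. -/
def azrpToAsep {N : ℕ} (x : AZRPConfig N) : ASEPConfig N :=
  ⟨fun i => x.1 i + ((i : ℤ) + 1), fun i j hij => by
    have h1 := x.2 hij.le
    have h2 : (i : ℤ) < (j : ℤ) := by exact_mod_cast hij
    show x.1 i + ((i : ℤ) + 1) < x.1 j + ((j : ℤ) + 1)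
    linarith⟩

/-- The distribution of the position at time `t` of the particle with number `m + 1` from the left
in the ASEP started from `Y`. -/
noncomputable def asepPositionLaw {N : ℕ} (p q : ℝ≥0) (t : ℝ≥0) (Y : ASEPConfig N) (m : Fin N) :
    PMF ℤ :=
  ((asep N p q).law t Y).map fun X => X.1 m

/-- The distribution of the position at time `t` of the particle with number `m + 1` from the left
in the AZRP started from `Y`. -/
noncomputable def azrpPositionLaw {N : ℕ} (p q : ℝ≥0) (t : ℝ≥0) (Y : AZRPConfig N) (m : Fin N) :
    PMF ℤ :=
  ((azrp N p q).law t Y).map fun X => X.1 m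

/-! The shift `azrpToAsep` carries the jump rates of the AZRP to those of the ASEP, and a chain with
bounded exit rates is determined by its rates, so all transition probabilities correspond. The rates
agree for a combinatorial reason. Particles stacked at one AZRP site become a block of particles on
adjacent ASEP sites. In such a block exclusion lets at most the rightmost particle jump right and
the leftmost jump left; in the ordered AZRP list, the particle leaving a stack must likewise be
taken as the last one for a right move and the first one for a left move. An occupied site thus
contributes one move in each direction, whatever the height of the stack. In the ASEP a move of the
rightmost particle may still be blocked only by a particle next to it, which would belong to the
same block, so nothing is lost. The matching of sites with movable particles is
`AZRPConfig.sum_isMove_eq_sum_update`; the passage from rates to probabilities is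
`JumpRates.transitionProb_equiv`, which rests on uniqueness of the transition function. The
one-particle laws follow by summing over configurations. -/

namespace JumpRates

/-! ### Transport of Markov chains along a bijection -/

variable {S S' : Type}

/-- The diagonal entry contains the total exit rate, a sum over all target states; surjectivity of
`e` ensures that no target is missed. -/
theorem generator_equiv {r : JumpRates S} {r' : JumpRates S'} (e : S ≃ S')
    (h : ∀ y x, r.rate y x = r'.rate (e y) (e x)) (y x : S) :
    r.generator y x = r'.generator (e y) (e x) := by
  have h1 : ∑' z, r.rate y z = ∑' z, r'.rate (e y) z := by
    rw [← e.tsum_eq]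
    exact tsum_congr fun z => h y z
  unfold generator
  rw [h, h1]
  by_cases hyx : y = x <;> simp [hyx]

theorem IsTransitionFunction.comp_equiv {r : JumpRates S} {r' : JumpRates S'} (e : S ≃ S')
    (h : ∀ y x, r.rate y x = r'.rate (e y) (e x)) {P : ℝ≥0 → S' → S' → ℝ}
    (hP : r'.IsTransitionFunction P) :
    r.IsTransitionFunction fun t y x => P t (e y) (e x) where
  nonneg t y x := hP.nonneg t _ _
  hasSum_one t y := e.hasSum_iff.2 (hP.hasSum_one t (e y))
  initial y x := by
    rw [hP.initial]
    by_cases hyx : y = x <;> simp [hyx]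
  chapman_kolmogorov s t y x := e.hasSum_iff.2 (hP.chapman_kolmogorov s t (e y) (e x))
  deriv_zero y x := by
    rw [generator_equiv e h]
    exact hP.deriv_zero (e y) (e x)

/-- Chains whose jump rates correspond under a bijection of the state spaces have the same
transition probabilities. -/
theorem transitionProb_equiv {r : JumpRates S} {r' : JumpRates S'} (e : S ≃ S')
    (h : ∀ y x, r.rate y x = r'.rate (e y) (e x)) (t : ℝ≥0) (y x : S) :
    r.transitionProb t y x = r'.transitionProb t (e y) (e x) := by
  have h1 := r.isTransitionFunction_transitionProb.unique
    (r'.isTransitionFunction_transitionProb.comp_equiv e h)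
  exact congrFun (congrFun (congrFun h1 t) y) x

end JumpRates

/-! ### The shift map on configurations -/

theorem azrpToAsep_bijective (N : ℕ) :
    Function.Bijective (azrpToAsep : AZRPConfig N → ASEPConfig N) := by
  refine ⟨fun x y h => Subtype.ext (funext fun i => ?_), fun z => ?_⟩
  · exact add_right_cancel (congrFun (congrArg Subtype.val h) i)
  · have hmono : Monotone fun i : Fin N => z.1 i - ((i : ℤ) + 1) := by
      -- Neighbouring positions in `z` differ by at least 1, which is what the shift removes. The
      -- comparison of neighbours lives on `Fin (n + 1)`, so the empty system is split off.
      cases N with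
      | zero => exact fun i => i.elim0
      | succ n =>
        refine Fin.monotone_iff_le_succ.2 fun i => ?_
        have := z.2 (Fin.castSucc_lt_succ (i := i))
        simp only [Fin.val_castSucc, Fin.val_succ]
        push_cast
        omega
    exact ⟨⟨_, hmono⟩, Subtype.ext (funext fun i => sub_add_cancel _ _)⟩

/-- Each coordinate is shifted by a constant depending only on its index, which cancels. Suppressed
jumps need no separate case: the updated tuple is then not the tuple of any configuration. -/
theorem azrpToAsep_eq_update_iff {N : ℕ} (y x : AZRPConfig N) (i : Fin N) (d : ℤ) :
    (azrpToAsep x).1 = Function.update (azrpToAsep y).1 i ((azrpToAsep y).1 i + d) ↔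
      x.1 = Function.update y.1 i (y.1 i + d) := by
  simp only [funext_iff]
  refine forall_congr' fun j => ?_
  by_cases hj : j = i
  · subst hj
    simp only [azrpToAsep, Function.update_self]
    omega
  · simp [azrpToAsep, Function.update_of_ne hj]

/-! ### Moves of sites versus moves of particles -/

namespace AZRPConfig

variable {N : ℕ}

/-- Occupation numbers are sums of indicators over the particles, and only the indicator of particle
`i` changes. -/
theorem isMove_of_eq_update {y x : AZRPConfig N} {i : Fin N} {s' : ℤ}
    (h : x.1 = Function.update y.1 i s') : y.IsMove x (y.1 i) s' := by
  have hocc : ∀ (z : AZRPConfig N) (s : ℤ), z.occupation s =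
      (if z.1 i = s then 1 else 0) + ∑ j ∈ Finset.univ.erase i, if z.1 j = s then 1 else 0 := by
    intro z s
    rw [Finset.add_sum_erase _ (fun j => if z.1 j = s then 1 else 0) (Finset.mem_univ i),
      occupation, Finset.card_filter]
  funext s
  have h1 : ∑ j ∈ Finset.univ.erase i, (if x.1 j = s then 1 else 0) =
      ∑ j ∈ Finset.univ.erase i, if y.1 j = s then 1 else 0 :=
    Finset.sum_congr rfl fun j hj => by rw [h, Function.update_of_ne (Finset.ne_of_mem_erase hj)]
  have h2 : x.1 i = s' := by rw [h, Function.update_self]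
  simp only [Pi.add_apply, hocc, h1, h2, Pi.single_apply, eq_comm (a := s)]
  omega

/-- The last particle at an occupied site can move to the right, and the first one to the left,
without destroying the order of the particles. -/
theorem exists_monotone_update (y : AZRPConfig N) {s d : ℤ} (hs : s ∈ y.occupiedSites)
    (hd : d = 1 ∨ d = -1) : ∃ i, y.1 i = s ∧ Monotone (Function.update y.1 i (y.1 i + d)) := by
  have hne : (Finset.univ.filter fun i => y.1 i = s).Nonempty := by
    obtain ⟨i, -, hi⟩ := Finset.mem_image.1 hs
    exact ⟨i, by simpa using hi⟩
  rcases hd with rfl | rfl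
  · obtain ⟨i, hi, hmax⟩ := Finset.exists_max_image _ id hne
    simp only [Finset.mem_filter, Finset.mem_univ, true_and, id] at hi hmax
    refine ⟨i, hi, fun a b hab => ?_⟩
    have h1 := y.2 hab
    -- By maximality of `i`, every later particle sits strictly to the right of `s`, hence at `s +
    -- 1` or beyond, which leaves room for the step.
    have h2 : a = i → b ≠ i → y.1 b ≠ s := fun ha hb hbs =>
      hb (le_antisymm (hmax b hbs) (ha ▸ hab))
    simp only [Function.update_apply]
    split_ifs with ha hb hb
    · rfl
    · have := h2 ha hb
      subst ha
      omega
    · subst hb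
      omega
    · exact h1
  · obtain ⟨i, hi, hmin⟩ := Finset.exists_min_image _ id hne
    simp only [Finset.mem_filter, Finset.mem_univ, true_and, id] at hi hmin
    refine ⟨i, hi, fun a b hab => ?_⟩
    have h1 := y.2 hab
    have h2 : b = i → a ≠ i → y.1 a ≠ s := fun hb ha has =>
      ha (le_antisymm (hb ▸ hab) (hmin a has))
    simp only [Function.update_apply]
    split_ifs with ha hb hb
    · rfl
    · subst ha
      omega
    · have := h2 hb ha
      subst hb
      omega
    · exact h1

open Classical in
-- For a fixed target `x`, sending a particle to its site is a bijection from the particles whose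
-- displacement by `d` produces `x` onto the sites from which a move by `d` produces `x`.
theorem sum_isMove_eq_sum_update (y x : AZRPConfig N) {d : ℤ} (hd : d = 1 ∨ d = -1) (c : ℝ) :
    ∑ s ∈ y.occupiedSites, (if y.IsMove x s (s + d) then c else 0) =
      ∑ i : Fin N, if x.1 = Function.update y.1 i (y.1 i + d) then c else 0 := by
  rw [← Finset.sum_filter, ← Finset.sum_filter, Finset.sum_const, Finset.sum_const]
  congr 1
  symm
  refine Finset.card_bij (fun i _ => y.1 i) (fun i hi => ?_) (fun i hi j hj _ => ?_)
    (fun s hs => ?_)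
  · have h := (Finset.mem_filter.1 hi).2
    exact Finset.mem_filter.2 ⟨Finset.mem_image_of_mem _ (Finset.mem_univ i),
      isMove_of_eq_update h⟩
  · have h1 := congrFun ((Finset.mem_filter.1 hi).2) i
    have h2 := congrFun ((Finset.mem_filter.1 hj).2) i
    by_contra hij
    rw [Function.update_self] at h1
    rw [Function.update_of_ne hij] at h2
    omega
  · obtain ⟨hs, hmove⟩ := Finset.mem_filter.1 hs
    obtain ⟨i, rfl, hi⟩ := y.exists_monotone_update hs hd
    refine ⟨i, Finset.mem_filter.2 ⟨Finset.mem_univ i, ?_⟩, rfl⟩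
    -- The order-preserving update is a configuration reached by the same move as `x`; occupation
    -- numbers determine the configuration, so it is `x`.
    exact congrArg Subtype.val (hmove.unique (isMove_of_eq_update (x := ⟨_, hi⟩) rfl))

end AZRPConfig

/-! ### Equality of rates and the conclusion -/

theorem azrp_rate_eq_asep_rate {N : ℕ} (p q : ℝ≥0) (y x : AZRPConfig N) :
    (azrp N p q).rate y x = (asep N p q).rate (azrpToAsep y) (azrpToAsep x) := by
  classical
  have hp := y.sum_isMove_eq_sum_update x (Or.inl rfl) p
  have hq := y.sum_isMove_eq_sum_update x (Or.inr rfl) q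
  simp only [azrp, asep, sub_eq_add_neg, azrpToAsep_eq_update_iff, Finset.sum_add_distrib]
  convert congrArg₂ (· + ·) hp hq

theorem mainTheorem3 (N : ℕ) (p q : ℝ≥0) (hpq : p + q = 1) :
    Function.Bijective (azrpToAsep : AZRPConfig N → ASEPConfig N) ∧
    (∀ (t : ℝ≥0) (Y X : AZRPConfig N),
      (azrp N p q).transitionProb t Y X =
        (asep N p q).transitionProb t (azrpToAsep Y) (azrpToAsep X)) ∧
    (∀ (t : ℝ≥0) (Y : AZRPConfig N) (m : Fin N) (x : ℤ),
      azrpPositionLaw p q t Y m x =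
        asepPositionLaw p q t (azrpToAsep Y) m (x + ((m : ℤ) + 1))) := by
  have hprob : ∀ (t : ℝ≥0) (Y X : AZRPConfig N), (azrp N p q).transitionProb t Y X =
      (asep N p q).transitionProb t (azrpToAsep Y) (azrpToAsep X) :=
    JumpRates.transitionProb_equiv (Equiv.ofBijective _ (azrpToAsep_bijective N))
      (azrp_rate_eq_asep_rate p q)
  refine ⟨azrpToAsep_bijective N, hprob, fun t Y m x => ?_⟩
  -- Both marginals are sums over configurations; reindexing the ASEP sum by the shift allows a
  -- termwise comparison.
  rw [azrpPositionLaw, asepPositionLaw, PMF.map_apply, PMF.map_apply,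
    ← (Equiv.ofBijective _ (azrpToAsep_bijective N)).tsum_eq]
  refine tsum_congr fun X => ?_
  have h1 : (azrp N p q).law t Y X = (asep N p q).law t (azrpToAsep Y) (azrpToAsep X) :=
    congrArg ENNReal.ofReal (hprob t Y X)
  -- Indices start at 0, so `m` is particle number `m + 1` and its shift is `m + 1`.
  have h2 : x + ((m : ℤ) + 1) = (azrpToAsep X).1 m ↔ x = X.1 m := add_left_inj _
  simp only [Equiv.ofBijective_apply, h1, h2]
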